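/- Let $d_1 \le d_2$ be non-negative integers. In $\mathbb{C}[a,b,c,d]$ define the ideal $$J(d_1,d_2) = (a,b)^{d_1} \cap (c,d)^{d_2} \cap (a-c,b-d)^{d_1},$$ and define ideals $J'(d_1,d_2) \subseteq \mathbb{C}[t_1,t_2,t_3,x_1,x_2,x_3]$ and $\mathcal{J}(d_1,d_2) \subseteq \mathbb{C}[t_1,t_2,t_3,x_1^{\pm 1},x_2^{\pm 1},x_3^{\pm 1}]$ by the same formula $$(t_1-t_2,\,x_1-x_2)^{d_1} \cap (t_1-t_3,\,x_1-x_3)^{d_1} \cap (t_2-t_3,\,x_2-x_3)^{d_2},$$ the generated ideals, powers and intersections being taken in the respective ring; $J$, $J'$ and $\mathcal{J}$ are defined in this way for all pairs of non-negative integers, with zeroth powers equal to the unit ideal. Then $$J(d_1,d_2) = J(1,1)^{d_1}\cdot J(0,1)^{d_2-d_1},$$ $$J'(d_1,d_2) = J'(1,1)^{d_1}\cdot J'(0,1)^{d_2-d_1},$$ $$\mathcal{J}(d_1,d_2) = \mathcal{J}(1,1)^{d_1}\cdot \mathcal{J}(0,1)^{d_2-d_1}.$$ -/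

import Mathlib

noncomputable section

namespace HaimanIdeal

open MvPolynomial

/-- The polynomial ring `ℂ[a, b, c, d]`. -/
abbrev PolyABCD : Type := MvPolynomial (Fin 4) ℂ

/-- The variable `a`. -/
def a : PolyABCD := X 0

/-- The variable `b`. -/
def b : PolyABCD := X 1

/-- The variable `c`. -/
def c : PolyABCD := X 2

/-- The variable `d`. -/
def d : PolyABCD := X 3

/-- The ideal `J(d₁, d₂) = (a, b)^{d₁} ∩ (c, d)^{d₂} ∩ (a - c, b - d)^{d₁}` of `ℂ[a, b, c, d]`. -/
def J (d₁ d₂ : ℕ) : Ideal PolyABCD :=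
  Ideal.span {a, b} ^ d₁ ⊓ Ideal.span {c, d} ^ d₂ ⊓ Ideal.span {a - c, b - d} ^ d₁

/-- The polynomial ring `ℂ[t₁, t₂, t₃, x₁, x₂, x₃]`; `Sum.inl i` indexes the `t`-variables and
`Sum.inr i` the `x`-variables (with `i = 0, 1, 2`). -/
abbrev PolyTX : Type := MvPolynomial (Fin 3 ⊕ Fin 3) ℂ

/-- The variables `t₁, t₂, t₃`. -/
def t (i : Fin 3) : PolyTX := X (Sum.inl i)

/-- The variables `x₁, x₂, x₃`. -/
def x (i : Fin 3) : PolyTX := X (Sum.inr i)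

/-- The ideal `J'(d₁, d₂) = (t₁ - t₂, x₁ - x₂)^{d₁} ∩ (t₁ - t₃, x₁ - x₃)^{d₁} ∩
(t₂ - t₃, x₂ - x₃)^{d₂}` of `ℂ[t₁, t₂, t₃, x₁, x₂, x₃]`. -/
def J' (d₁ d₂ : ℕ) : Ideal PolyTX :=
  Ideal.span {t 0 - t 1, x 0 - x 1} ^ d₁ ⊓ Ideal.span {t 0 - t 2, x 0 - x 2} ^ d₁ ⊓
    Ideal.span {t 1 - t 2, x 1 - x 2} ^ d₂

/-- The ring `ℂ[t₁, t₂, t₃, x₁^{±1}, x₂^{±1}, x₃^{±1}]`, polynomial in the `t`-variables and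
Laurent polynomial in the `x`-variables: the localization of `ℂ[t₁, t₂, t₃, x₁, x₂, x₃]` in which
`x₁ x₂ x₃` is inverted. -/
abbrev LaurentTX : Type := Localization.Away (x 0 * x 1 * x 2)

/-- The elements `t₁, t₂, t₃` of the Laurent ring. -/
def tL (i : Fin 3) : LaurentTX := algebraMap PolyTX LaurentTX (t i)

/-- The elements `x₁, x₂, x₃` of the Laurent ring. -/
def xL (i : Fin 3) : LaurentTX := algebraMap PolyTX LaurentTX (x i)

/-- The ideal `𝒥(d₁, d₂) = (t₁ - t₂, x₁ - x₂)^{d₁} ∩ (t₁ - t₃, x₁ - x₃)^{d₁} ∩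
(t₂ - t₃, x₂ - x₃)^{d₂}` of `ℂ[t₁, t₂, t₃, x₁^{±1}, x₂^{±1}, x₃^{±1}]`; the powers and the
intersection are taken in the Laurent ring. -/
def JLaurent (d₁ d₂ : ℕ) : Ideal LaurentTX :=
  Ideal.span {tL 0 - tL 1, xL 0 - xL 1} ^ d₁ ⊓ Ideal.span {tL 0 - tL 2, xL 0 - xL 2} ^ d₁ ⊓
    Ideal.span {tL 1 - tL 2, xL 1 - xL 2} ^ d₂

end HaimanIdeal

end

/-! Everything reduces to generic `a, b, c, d` over a domain `A`. Put Δ = ad - bc, which lies in `J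
1 1`. Modulo Δ the ring embeds in `A[s,t,p,q]` by the Segre map, which sends elements of the three
ideals to multiples of s, t and s - t. An element f of the intersection thus maps to a multiple of
s^m t^n (s - t)^m, and retracting gives f = g + Δy with g in the product of the three powers
(`mem_productIdeal_sup_span_det`). Since Δ has order exactly one along each ideal, y lies in the
intersection with all exponents lowered by one, and induction on m finishes (`tripleIdeal_le`). `J'`
follows by a linear change of variables over `ℂ[t₃, x₃]`, and `JLaurent` by localization; both
preserve intersections. -/

namespace HaimanIdeal

open MvPolynomial

/-! ### Triple intersections, and powers of ideals detected by a grading variable. -/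

section Generic

variable {R S : Type*} [CommRing R] [CommRing S]

/-- The ideal `(a, b)^m ∩ (c, d)^n ∩ (a - c, b - d)^m` of a commutative ring. -/
def tripleIdeal (a b c d : R) (m n : ℕ) : Ideal R :=
  Ideal.span {a, b} ^ m ⊓ Ideal.span {c, d} ^ n ⊓ Ideal.span {a - c, b - d} ^ m

lemma map_span_pair (f : R →+* S) (a b : R) :
    Ideal.map f (Ideal.span {a, b}) = Ideal.span {f a, f b} := by
  rw [Ideal.map_span, Set.image_pair]

lemma map_tripleIdeal (f : R →+* S)
    (hf : ∀ I J : Ideal R, Ideal.map f (I ⊓ J) = Ideal.map f I ⊓ Ideal.map f J)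
    (a b c d : R) (m n : ℕ) :
    Ideal.map f (tripleIdeal a b c d m n) = tripleIdeal (f a) (f b) (f c) (f d) m n := by
  simp only [tripleIdeal, hf, Ideal.map_pow, map_span_pair, map_sub]

lemma tripleIdeal_eq_of_map (f : R →+* S)
    (hf : ∀ I J : Ideal R, Ideal.map f (I ⊓ J) = Ideal.map f I ⊓ Ideal.map f J)
    {a b c d : R} {m n : ℕ}
    (h : tripleIdeal a b c d m n =
      tripleIdeal a b c d 1 1 ^ m * tripleIdeal a b c d 0 1 ^ (n - m)) :
    tripleIdeal (f a) (f b) (f c) (f d) m n =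
      tripleIdeal (f a) (f b) (f c) (f d) 1 1 ^ m *
        tripleIdeal (f a) (f b) (f c) (f d) 0 1 ^ (n - m) := by
  simp only [← map_tripleIdeal f hf, ← Ideal.map_pow, ← Ideal.map_mul, ← h]

lemma map_inf_of_ringEquiv (e : R ≃+* S) (I J : Ideal R) :
    Ideal.map (e : R →+* S) (I ⊓ J) = Ideal.map (e : R →+* S) I ⊓ Ideal.map (e : R →+* S) J := by
  simp only [Ideal.map_comap_of_equiv, Ideal.comap_inf]

lemma tripleIdeal_zero_one (a b c d : R) : tripleIdeal a b c d 0 1 = Ideal.span {c, d} := by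
  simp [tripleIdeal]

/-- The easy inclusion: the products lie in the intersection. -/
lemma pow_mul_pow_le_tripleIdeal (a b c d : R) {m n : ℕ} (h : m ≤ n) :
    tripleIdeal a b c d 1 1 ^ m * tripleIdeal a b c d 0 1 ^ (n - m) ≤ tripleIdeal a b c d m n := by
  rw [tripleIdeal_zero_one]
  refine le_inf (le_inf ?_ ?_) ?_
  · refine Ideal.mul_le_left.trans (Ideal.pow_right_mono ?_ m)
    simpa [tripleIdeal] using inf_le_left.trans inf_le_left
  · conv_rhs => rw [← Nat.add_sub_cancel' h, pow_add]
    refine Ideal.mul_mono_left (Ideal.pow_right_mono ?_ m)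
    simpa [tripleIdeal] using inf_le_left.trans inf_le_right
  · refine Ideal.mul_le_left.trans (Ideal.pow_right_mono ?_ m)
    simp [tripleIdeal]

lemma pow_dvd_map_of_mem_pow (f : R →+* S) {I : Ideal R} {s : S} (hI : ∀ r ∈ I, s ∣ f r)
    {k : ℕ} {r : R} (hr : r ∈ I ^ k) : s ^ k ∣ f r := by
  have h : Ideal.map f I ≤ Ideal.span {s} :=
    Ideal.map_le_iff_le_comap.2 fun r hr => Ideal.mem_span_singleton.2 (hI r hr)
  rw [← Ideal.mem_span_singleton, ← Ideal.span_singleton_pow]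
  exact Ideal.pow_right_mono h k (Ideal.map_pow f I k ▸ Ideal.mem_map_of_mem f hr)

lemma dvd_map_of_mem_span_pair (f : R →+* S) {a b : R} {s : S} (ha : s ∣ f a) (hb : s ∣ f b) :
    ∀ r ∈ Ideal.span {a, b}, s ∣ f r := by
  intro r hr
  obtain ⟨x, y, rfl⟩ := Ideal.mem_span_pair.1 hr
  rw [map_add, map_mul, map_mul]
  exact dvd_add (ha.mul_left _) (hb.mul_left _)

lemma pow_dvd_map_of_mem_span_pair_pow (f : R →+* S) {a b : R} {s : S} (ha : s ∣ f a)
    (hb : s ∣ f b) {k : ℕ} {r : R} (hr : r ∈ Ideal.span {a, b} ^ k) : s ^ k ∣ f r :=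
  pow_dvd_map_of_mem_pow f (dvd_map_of_mem_span_pair f ha hb) hr

/-- If a ring homomorphism `τ : R → R[X]` with values in the Rees algebra of `I` splits evaluation
at `1`, then `X`-divisibility of `τ r` detects membership of `r` in the powers of `I`. -/
lemma mem_pow_of_X_pow_dvd {I : Ideal R} (τ : R →+* Polynomial R)
    (heval : ∀ r, (τ r).eval 1 = r) (hrees : ∀ r, τ r ∈ reesAlgebra I)
    {k : ℕ} {r : R} (h : Polynomial.X ^ k ∣ τ r) : r ∈ I ^ k := by
  -- `r` is the sum of the coefficients of `τ r`; the `i`-th lies in `I ^ i` and vanishes for `i <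
  -- k`.
  rw [← heval r, Polynomial.eval_eq_sum, Polynomial.sum_def]
  refine Ideal.sum_mem _ fun i _ => ?_
  rw [one_pow, mul_one]
  rcases lt_or_ge i k with hi | hi
  · rw [Polynomial.X_pow_dvd_iff.1 h i hi]
    exact zero_mem _
  · exact Ideal.pow_le_pow_right hi (hrees r i)

/-- `τ Δ` contributes a single factor `X`. After cancelling it, the prime `X` does not divide the
nonzero constant Δ, so the other `k` factors divide `τ r`. -/
lemma mem_pow_of_mul_mem_pow_succ [IsDomain R] {p q Δ : R} (τ : R →+* Polynomial R)
    (heval : ∀ r, (τ r).eval 1 = r) (hrees : ∀ r, τ r ∈ reesAlgebra (Ideal.span {p, q}))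
    (hp : Polynomial.X ∣ τ p) (hq : Polynomial.X ∣ τ q)
    (hτ : τ Δ = Polynomial.X * Polynomial.C Δ) (hΔ : Δ ≠ 0) {k : ℕ} {r : R}
    (h : Δ * r ∈ Ideal.span {p, q} ^ (k + 1)) : r ∈ Ideal.span {p, q} ^ k := by
  refine mem_pow_of_X_pow_dvd τ heval hrees ?_
  have h' := pow_dvd_map_of_mem_span_pair_pow τ hp hq h
  rw [map_mul, hτ, pow_succ', mul_assoc, mul_dvd_mul_iff_left Polynomial.X_ne_zero] at h'
  refine Polynomial.prime_X.pow_dvd_of_dvd_mul_left k ?_ h'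
  rwa [Polynomial.X_dvd_iff, Polynomial.coeff_C_zero]

end Generic

/-! ### Dividing by the determinant lowers the order along each ideal by one. -/

section Determinant

variable {A : Type*} [CommRing A]

/-- The determinant `ad - bc` in the polynomial ring in four variables. -/
noncomputable def det : MvPolynomial (Fin 4) A := X 0 * X 3 - X 1 * X 2

lemma det_ne_zero [Nontrivial A] : (det : MvPolynomial (Fin 4) A) ≠ 0 := by
  intro h
  have := congrArg (eval ![1, 0, 0, 1]) h
  simp [det] at this

lemma reesAlgebra_eval_one {v : Fin 4 → Polynomial (MvPolynomial (Fin 4) A)}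
    (hv : ∀ i, (v i).eval 1 = X i) (f : MvPolynomial (Fin 4) A) :
    (aeval v f).eval 1 = f := by
  induction f using MvPolynomial.induction_on with
  | C r => simp [MvPolynomial.algebraMap_eq]
  | add f g hf hg => simp [hf, hg]
  | mul_X f i hf => simp [hf, hv]

lemma aeval_mem_reesAlgebra {I : Ideal (MvPolynomial (Fin 4) A)}
    {v : Fin 4 → Polynomial (MvPolynomial (Fin 4) A)}
    (hv : ∀ i, v i ∈ reesAlgebra I) (f : MvPolynomial (Fin 4) A) :
    aeval v f ∈ reesAlgebra I := by
  induction f using MvPolynomial.induction_on with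
  | C r =>
    rw [MvPolynomial.aeval_C]
    exact Subalgebra.algebraMap_mem (reesAlgebra I) (C r)
  | add f g hf hg => rw [map_add]; exact add_mem hf hg
  | mul_X f i hf => rw [map_mul, aeval_X]; exact mul_mem hf (hv i)

lemma C_mul_X_mem_reesAlgebra {R : Type*} [CommRing R] {I : Ideal R} {r : R} (hr : r ∈ I) :
    Polynomial.C r * Polynomial.X ∈ reesAlgebra I := by
  rw [← pow_one Polynomial.X, Polynomial.C_mul_X_pow_eq_monomial]
  exact reesAlgebra.monomial_mem.2 (by rwa [pow_one])

lemma C_mem_reesAlgebra {R : Type*} [CommRing R] (I : Ideal R) (r : R) :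
    Polynomial.C r ∈ reesAlgebra I :=
  Subalgebra.algebraMap_mem (reesAlgebra I) r

variable [IsDomain A]

lemma mem_pow_of_det_mul_mem {p q : MvPolynomial (Fin 4) A}
    (v : Fin 4 → Polynomial (MvPolynomial (Fin 4) A))
    (hv : ∀ i, (v i).eval 1 = X i) (hv' : ∀ i, v i ∈ reesAlgebra (Ideal.span {p, q}))
    (hp : aeval v p = Polynomial.C p * Polynomial.X)
    (hq : aeval v q = Polynomial.C q * Polynomial.X)
    (hdet : aeval v (det : MvPolynomial (Fin 4) A) = Polynomial.X * Polynomial.C det)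
    {k : ℕ} {f : MvPolynomial (Fin 4) A}
    (h : det * f ∈ Ideal.span {p, q} ^ (k + 1)) : f ∈ Ideal.span {p, q} ^ k :=
  mem_pow_of_mul_mem_pow_succ (aeval v : _ →ₐ[A] _).toRingHom
    (reesAlgebra_eval_one hv) (aeval_mem_reesAlgebra hv') (Dvd.intro_left _ hp.symm)
    (Dvd.intro_left _ hq.symm) hdet det_ne_zero h

lemma mem_pow_of_det_mul_mem_ab {k : ℕ} {f : MvPolynomial (Fin 4) A}
    (h : det * f ∈ Ideal.span {X 0, X 1} ^ (k + 1)) : f ∈ Ideal.span {X 0, X 1} ^ k := by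
  refine mem_pow_of_det_mul_mem
    ![Polynomial.C (X 0) * Polynomial.X, Polynomial.C (X 1) * Polynomial.X,
      Polynomial.C (X 2), Polynomial.C (X 3)] ?_ ?_ ?_ ?_ ?_ h
  · intro i; fin_cases i <;> simp
  · intro i
    fin_cases i
    · exact C_mul_X_mem_reesAlgebra (Ideal.subset_span (by simp))
    · exact C_mul_X_mem_reesAlgebra (Ideal.subset_span (by simp))
    · exact C_mem_reesAlgebra _ _
    · exact C_mem_reesAlgebra _ _
  · simp
  · simp
  · simp [det]; ring

lemma mem_pow_of_det_mul_mem_cd {k : ℕ} {f : MvPolynomial (Fin 4) A}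
    (h : det * f ∈ Ideal.span {X 2, X 3} ^ (k + 1)) : f ∈ Ideal.span {X 2, X 3} ^ k := by
  refine mem_pow_of_det_mul_mem
    ![Polynomial.C (X 0), Polynomial.C (X 1),
      Polynomial.C (X 2) * Polynomial.X, Polynomial.C (X 3) * Polynomial.X] ?_ ?_ ?_ ?_ ?_ h
  · intro i; fin_cases i <;> simp
  · intro i
    fin_cases i
    · exact C_mem_reesAlgebra _ _
    · exact C_mem_reesAlgebra _ _
    · exact C_mul_X_mem_reesAlgebra (Ideal.subset_span (by simp))
    · exact C_mul_X_mem_reesAlgebra (Ideal.subset_span (by simp))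
  · simp
  · simp
  · simp [det]; ring

lemma mem_pow_of_det_mul_mem_sub {k : ℕ} {f : MvPolynomial (Fin 4) A}
    (h : det * f ∈ Ideal.span {X 0 - X 2, X 1 - X 3} ^ (k + 1)) :
    f ∈ Ideal.span {X 0 - X 2, X 1 - X 3} ^ k := by
  -- Here a ↦ c + (a - c)X and b ↦ d + (b - d)X: the differences are scaled and c, d stay fixed.
  refine mem_pow_of_det_mul_mem
    ![Polynomial.C (X 0 - X 2) * Polynomial.X + Polynomial.C (X 2),
      Polynomial.C (X 1 - X 3) * Polynomial.X + Polynomial.C (X 3),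
      Polynomial.C (X 2), Polynomial.C (X 3)] ?_ ?_ ?_ ?_ ?_ h
  · intro i; fin_cases i <;> simp
  · intro i
    fin_cases i
    · exact add_mem (C_mul_X_mem_reesAlgebra (Ideal.subset_span (by simp))) (C_mem_reesAlgebra _ _)
    · exact add_mem (C_mul_X_mem_reesAlgebra (Ideal.subset_span (by simp))) (C_mem_reesAlgebra _ _)
    · exact C_mem_reesAlgebra _ _
    · exact C_mem_reesAlgebra _ _
  · simp
  · simp
  · simp [det]; ring

end Determinant

end HaimanIdeal

namespace HaimanIdeal

open MvPolynomial

/-! ### The Segre embedding, its retraction, and the generic theorem. -/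

section Segre

variable {A : Type*} [CommRing A]

/-- The Segre homomorphism `a ↦ sp, b ↦ sq, c ↦ tp, d ↦ tq`, where `s, t, p, q` are the variables
of the target. -/
noncomputable def segre : MvPolynomial (Fin 4) A →ₐ[A] MvPolynomial (Fin 4) A :=
  aeval ![X 0 * X 2, X 0 * X 3, X 1 * X 2, X 1 * X 3]

@[simp] lemma segre_X_zero : segre (X 0 : MvPolynomial (Fin 4) A) = X 0 * X 2 := by simp [segre]
@[simp] lemma segre_X_one : segre (X 1 : MvPolynomial (Fin 4) A) = X 0 * X 3 := by simp [segre]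
@[simp] lemma segre_X_two : segre (X 2 : MvPolynomial (Fin 4) A) = X 1 * X 2 := by simp [segre]
@[simp] lemma segre_X_three : segre (X 3 : MvPolynomial (Fin 4) A) = X 1 * X 3 := by simp [segre]

lemma monomial_fin_four (m : Fin 4 →₀ ℕ) :
    monomial m (1 : A) = X 0 ^ m 0 * X 1 ^ m 1 * X 2 ^ m 2 * X 3 ^ m 3 := by
  rw [monomial_eq, C_1, one_mul, Finsupp.prod_fintype _ _ (by simp), Fin.prod_univ_four]

variable (A) in
/-- The coordinate ring of the Segre cone `ad = bc`. -/
abbrev SegreRing : Type _ := MvPolynomial (Fin 4) A ⧸ Ideal.span {(det : MvPolynomial (Fin 4) A)}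

/-- The quotient map onto the coordinate ring of the Segre cone. -/
noncomputable abbrev segreMk : MvPolynomial (Fin 4) A →ₐ[A] SegreRing A :=
  Ideal.Quotient.mkₐ A (Ideal.span {(det : MvPolynomial (Fin 4) A)})

/-- The class in the Segre ring of the preimage of a monomial `s^i t^j p^k q^l` with
`i + j = k + l`, and zero for the other monomials. -/
noncomputable def segreRetractMonomial (m : Fin 4 →₀ ℕ) : SegreRing A :=
  -- The exponents of a, b, c, d form a 2 × 2 table with row sums `m 0, m 1` and column sums `m 2, m
  -- 3`. By truncated subtraction b or c gets exponent zero, a normal form modulo ad = bc.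
  if m 0 + m 1 = m 2 + m 3 then
    segreMk (A := A) (X 0 ^ min (m 0) (m 2) * X 1 ^ (m 0 - m 2) * X 2 ^ (m 2 - m 0) *
      X 3 ^ min (m 1) (m 3))
  else 0

/-- An `A`-linear left inverse of the map induced by `segre` on the Segre ring. -/
noncomputable def segreRetract : MvPolynomial (Fin 4) A →ₗ[A] SegreRing A :=
  (basisMonomials (Fin 4) A).constr A (segreRetractMonomial (A := A))

lemma segreRetract_monomial (m : Fin 4 →₀ ℕ) :
    segreRetract (monomial m (1 : A)) = segreRetractMonomial (A := A) m := by
  have := (basisMonomials (Fin 4) A).constr_basis A (segreRetractMonomial (A := A)) m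
  rwa [coe_basisMonomials] at this

lemma segreMk_mul_eq :
    (segreMk (X 0) * segreMk (X 3) : SegreRing A) = segreMk (X 1) * segreMk (X 2) := by
  rw [← map_mul, ← map_mul]
  exact Ideal.Quotient.eq.2 (Ideal.subset_span rfl)

lemma segreRetract_segre (f : MvPolynomial (Fin 4) A) : segreRetract (segre f) = segreMk f := by
  have key : segreRetract ∘ₗ segre.toLinearMap = (segreMk (A := A)).toLinearMap := by
    refine (basisMonomials (Fin 4) A).ext fun m => ?_
    simp only [coe_basisMonomials, LinearMap.comp_apply, AlgHom.toLinearMap_apply]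
    have h : segre (monomial m (1 : A)) =
        monomial (Finsupp.equivFunOnFinite.symm
          ![m 0 + m 1, m 2 + m 3, m 0 + m 2, m 1 + m 3]) 1 := by
      rw [monomial_fin_four, monomial_fin_four]
      simp
      ring
    rw [h, segreRetract_monomial, segreRetractMonomial, monomial_fin_four m]
    have h₂ : m 0 + m 1 + (m 2 + m 3) = m 0 + m 2 + (m 1 + m 3) := by omega
    simp only [Finsupp.equivFunOnFinite_symm_apply_apply, Matrix.cons_val, h₂, if_true]
    simp only [map_mul, map_pow]
    -- The normal form trades (bc)^min for (ad)^min, where min is the smaller of `m 1` and `m 2`.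
    rcases le_total (m 1) (m 2) with hle | hle
    · obtain ⟨e, he⟩ := Nat.exists_eq_add_of_le hle
      have e1 : min (m 0 + m 1) (m 0 + m 2) = m 0 + m 1 := by omega
      have e2 : m 0 + m 1 - (m 0 + m 2) = 0 := by omega
      have e3 : m 0 + m 2 - (m 0 + m 1) = e := by omega
      have e4 : min (m 2 + m 3) (m 1 + m 3) = m 1 + m 3 := by omega
      rw [e1, e2, e3, e4, he]
      linear_combination (exp := 1) segreMk (X 0) ^ m 0 * segreMk (X 2) ^ e * segreMk (X 3) ^ m 3 *
        congrArg (· ^ m 1) (segreMk_mul_eq (A := A))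
    · obtain ⟨e, he⟩ := Nat.exists_eq_add_of_le hle
      have e1 : min (m 0 + m 1) (m 0 + m 2) = m 0 + m 2 := by omega
      have e2 : m 0 + m 1 - (m 0 + m 2) = e := by omega
      have e3 : m 0 + m 2 - (m 0 + m 1) = 0 := by omega
      have e4 : min (m 2 + m 3) (m 1 + m 3) = m 2 + m 3 := by omega
      rw [e1, e2, e3, e4, he]
      linear_combination (exp := 1) segreMk (X 0) ^ m 0 * segreMk (X 1) ^ e * segreMk (X 3) ^ m 3 *
        congrArg (· ^ m 2) (segreMk_mul_eq (A := A))
  exact LinearMap.congr_fun key f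

/-- The weight for which `s, t` have degree `1` and `p, q` have degree `-1`. -/
def segreWeight : Fin 4 → ℤ := ![1, 1, -1, -1]

lemma weight_segreWeight (m : Fin 4 →₀ ℕ) :
    Finsupp.weight segreWeight m = (m 0 : ℤ) + m 1 - m 2 - m 3 := by
  rw [Finsupp.weight_apply, Finsupp.sum_fintype _ _ (by simp), Fin.sum_univ_four]
  simp [segreWeight]
  ring

lemma segreRetract_eq_zero {f : MvPolynomial (Fin 4) A} {n : ℤ}
    (hf : IsWeightedHomogeneous segreWeight f n) (hn : n ≠ 0) : segreRetract f = 0 := by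
  rw [f.as_sum, map_sum]
  refine Finset.sum_eq_zero fun m hm => ?_
  have hw := hf (mem_support_iff.1 hm)
  rw [weight_segreWeight] at hw
  rw [← mul_one (coeff m f), ← smul_eq_mul, ← smul_monomial, map_smul, segreRetract_monomial,
    segreRetractMonomial, if_neg (by omega), smul_zero]

/-- If `segre` maps elements of `I` onto all `F p^k q^l` with `k + l = n` and elements of `I'` onto
`l p` and `l q`, then it maps elements of `I' ^ m * I` onto all `l^m F p^k q^l` with
`k + l = n + m`. -/
lemma exists_segre_eq_pow_mul {I I' : Ideal (MvPolynomial (Fin 4) A)}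
    {F l : MvPolynomial (Fin 4) A} {n : ℕ}
    (hF : ∀ i j, i + j = n → ∃ f ∈ I, segre f = F * (X 2 ^ i * X 3 ^ j))
    (hp : ∃ f ∈ I', segre f = l * X 2) (hq : ∃ f ∈ I', segre f = l * X 3) (m : ℕ) :
    ∀ i j, i + j = n + m → ∃ f ∈ I' ^ m * I, segre f = l ^ m * F * (X 2 ^ i * X 3 ^ j) := by
  induction m with
  | zero => simpa using hF
  | succ m ih =>
    intro i j hij
    obtain ⟨f, hf, hfl⟩ := hp
    obtain ⟨g, hg, hgl⟩ := hq
    rcases i with _ | i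
    · obtain ⟨j, rfl⟩ : ∃ k, j = k + 1 := ⟨n + m, by omega⟩
      obtain ⟨y, hy, hyl⟩ := ih 0 j (by omega)
      refine ⟨g * y, ?_, ?_⟩
      · rw [pow_succ', mul_assoc]
        exact Ideal.mul_mem_mul hg hy
      · rw [map_mul, hgl, hyl]
        ring
    · obtain ⟨y, hy, hyl⟩ := ih i j (by omega)
      refine ⟨f * y, ?_, ?_⟩
      · rw [pow_succ', mul_assoc]
        exact Ideal.mul_mem_mul hf hy
      · rw [map_mul, hfl, hyl]
        ring

/-- The product of ideals `(a, b)^i (c, d)^j (a - c, b - d)^k`. -/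
noncomputable def productIdeal (i j k : ℕ) : Ideal (MvPolynomial (Fin 4) A) :=
  Ideal.span {X 0, X 1} ^ i * (Ideal.span {X 2, X 3} ^ j *
    Ideal.span {X 0 - X 2, X 1 - X 3} ^ k)

/-- The degree condition supplies exactly one p or q for each linear factor s, t or s - t. The
factors coming from `m` carry no ideal condition, hence `I' = ⊤` for them. -/
lemma exists_mem_productIdeal (i j k : ℕ) (m : Fin 4 →₀ ℕ)
    (hm : m 0 + m 1 + (i + j + k) = m 2 + m 3) :
    ∃ f ∈ productIdeal i j k, segre f =
      X 0 ^ i * X 1 ^ j * (X 0 - X 1) ^ k * monomial m (1 : A) := by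
  have h₀ : ∀ i j, i + j = 0 → ∃ f ∈ (⊤ : Ideal (MvPolynomial (Fin 4) A)),
      segre f = 1 * (X 2 ^ i * X 3 ^ j) := by
    intro i j hij
    obtain ⟨rfl, rfl⟩ : i = 0 ∧ j = 0 := by omega
    exact ⟨1, trivial, by simp⟩
  have h₁ := exists_segre_eq_pow_mul (I' := ⊤) (l := X 0) h₀
    ⟨X 0, trivial, segre_X_zero⟩ ⟨X 1, trivial, segre_X_one⟩ (m 0)
  have h₂ := exists_segre_eq_pow_mul (I' := ⊤) (l := X 1) h₁
    ⟨X 2, trivial, segre_X_two⟩ ⟨X 3, trivial, segre_X_three⟩ (m 1)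
  have h₃ := exists_segre_eq_pow_mul (I' := Ideal.span {X 0 - X 2, X 1 - X 3})
    (l := X 0 - X 1) h₂ ⟨X 0 - X 2, Ideal.subset_span (by simp), by simp; ring⟩
    ⟨X 1 - X 3, Ideal.subset_span (by simp), by simp; ring⟩ k
  have h₄ := exists_segre_eq_pow_mul (I' := Ideal.span {X 2, X 3}) (l := X 1) h₃
    ⟨X 2, Ideal.subset_span (by simp), segre_X_two⟩
    ⟨X 3, Ideal.subset_span (by simp), segre_X_three⟩ j
  have h₅ := exists_segre_eq_pow_mul (I' := Ideal.span {X 0, X 1}) (l := X 0) h₄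
    ⟨X 0, Ideal.subset_span (by simp), segre_X_zero⟩
    ⟨X 1, Ideal.subset_span (by simp), segre_X_one⟩ i
  obtain ⟨f, hf, hfe⟩ := h₅ (m 2) (m 3) (by omega)
  refine ⟨f, ?_, ?_⟩
  · simpa [productIdeal, ← Ideal.one_eq_top] using hf
  · rw [hfe, monomial_fin_four]
    ring

lemma segreRetract_mem_map_productIdeal (i j k : ℕ) (g : MvPolynomial (Fin 4) A) :
    segreRetract (X 0 ^ i * X 1 ^ j * (X 0 - X 1) ^ k * g) ∈
      Ideal.map segreMk (productIdeal i j k) := by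
  rw [g.as_sum, Finset.mul_sum, map_sum]
  refine Ideal.sum_mem _ fun m _ => ?_
  have hm' : monomial m (coeff m g) = coeff m g • monomial m (1 : A) := by
    rw [smul_monomial, smul_eq_mul, mul_one]
  rw [hm', mul_smul_comm, map_smul]
  refine Submodule.smul_of_tower_mem _ _ ?_
  by_cases hm : m 0 + m 1 + (i + j + k) = m 2 + m 3
  · obtain ⟨f, hf, hfe⟩ := exists_mem_productIdeal (A := A) i j k m hm
    rw [← hfe, segreRetract_segre]
    exact Ideal.mem_map_of_mem _ hf
  · have hX (r : Fin 4) : IsWeightedHomogeneous segreWeight (X r : MvPolynomial (Fin 4) A)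
        (segreWeight r) := isWeightedHomogeneous_X A segreWeight r
    -- The product has weight i + j + k + m 0 + m 1 - m 2 - m 3, nonzero here, so the retraction
    -- kills it.
    have h := ((((hX 0).pow i).mul ((hX 1).pow j)).mul
      (((hX 0).sub (hX 1 : IsWeightedHomogeneous segreWeight _ (segreWeight 0))).pow k)).mul
      (isWeightedHomogeneous_monomial segreWeight m (1 : A) (weight_segreWeight m))
    rw [segreRetract_eq_zero h]
    · exact zero_mem _
    · simp only [segreWeight, Matrix.cons_val, nsmul_eq_mul]
      omega

/-- Extracting the power of s - t first means that only s and t need be prime. -/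
lemma pow_mul_pow_mul_pow_dvd {R : Type*} [CommRing R] [IsDomain R] {s t F : R} (hs : Prime s)
    (ht : Prime t) (hst : ¬ s ∣ t) (hts : ¬ t ∣ s) {i j k : ℕ} (h₁ : s ^ i ∣ F) (h₂ : t ^ j ∣ F)
    (h₃ : (s - t) ^ k ∣ F) : s ^ i * t ^ j * (s - t) ^ k ∣ F := by
  obtain ⟨G, rfl⟩ := h₃
  have hs' : ¬ s ∣ (s - t) ^ k := fun h => hst ((dvd_sub_right dvd_rfl).1 (hs.dvd_of_dvd_pow h))
  have ht' : ¬ t ∣ (s - t) ^ k := fun h => hts ((dvd_sub_left dvd_rfl).1 (ht.dvd_of_dvd_pow h))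
  obtain ⟨G, rfl⟩ := hs.pow_dvd_of_dvd_mul_left i hs' h₁
  have h₄ := ht.pow_dvd_of_dvd_mul_left j ht' h₂
  obtain ⟨G, rfl⟩ := ht.pow_dvd_of_dvd_mul_left j (fun h => hts (ht.dvd_of_dvd_pow h)) h₄
  exact ⟨G, by ring⟩

lemma det_mem_tripleIdeal :
    (det : MvPolynomial (Fin 4) A) ∈ tripleIdeal (X 0) (X 1) (X 2) (X 3) 1 1 := by
  simp only [tripleIdeal, pow_one, Ideal.mem_inf, Ideal.mem_span_pair, det]
  exact ⟨⟨⟨X 3, -X 2, by ring⟩, ⟨-X 1, X 0, by ring⟩⟩, ⟨X 3, -X 2, by ring⟩⟩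

lemma productIdeal_le (m n : ℕ) :
    (productIdeal m (m + n) m : Ideal (MvPolynomial (Fin 4) A)) ≤
      tripleIdeal (X 0) (X 1) (X 2) (X 3) 1 1 ^ m * Ideal.span {X 2, X 3} ^ n := by
  have h : (Ideal.span {X 0, X 1} * Ideal.span {X 2, X 3} * Ideal.span {X 0 - X 2, X 1 - X 3} :
      Ideal (MvPolynomial (Fin 4) A)) ≤ tripleIdeal (X 0) (X 1) (X 2) (X 3) 1 1 := by
    simp only [tripleIdeal, pow_one]
    exact Ideal.mul_le_inf.trans (inf_le_inf_right _ Ideal.mul_le_inf)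
  calc (productIdeal m (m + n) m : Ideal (MvPolynomial (Fin 4) A))
      = (Ideal.span {X 0, X 1} * Ideal.span {X 2, X 3} * Ideal.span {X 0 - X 2, X 1 - X 3}) ^ m *
        Ideal.span {X 2, X 3} ^ n := by
        rw [productIdeal]; ring
    _ ≤ _ := Ideal.mul_mono_left (Ideal.pow_right_mono h m)

variable [IsDomain A]

lemma mem_productIdeal_sup_span_det {i j k : ℕ} {f : MvPolynomial (Fin 4) A}
    (h₁ : f ∈ Ideal.span {X 0, X 1} ^ i) (h₂ : f ∈ Ideal.span {X 2, X 3} ^ j)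
    (h₃ : f ∈ Ideal.span {X 0 - X 2, X 1 - X 3} ^ k) :
    f ∈ productIdeal i j k ⊔ Ideal.span {det} := by
  have d₁ : X 0 ^ i ∣ segre f :=
    pow_dvd_map_of_mem_span_pair_pow segre.toRingHom ⟨X 2, segre_X_zero⟩ ⟨X 3, segre_X_one⟩ h₁
  have d₂ : X 1 ^ j ∣ segre f :=
    pow_dvd_map_of_mem_span_pair_pow segre.toRingHom ⟨X 2, segre_X_two⟩ ⟨X 3, segre_X_three⟩ h₂
  have d₃ : (X 0 - X 1) ^ k ∣ segre f :=
    pow_dvd_map_of_mem_span_pair_pow segre.toRingHom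
      ⟨X 2, by simp; ring⟩ ⟨X 3, by simp; ring⟩ h₃
  obtain ⟨g, hg⟩ := pow_mul_pow_mul_pow_dvd X_prime X_prime
    (by simp [X_dvd_X]) (by simp [X_dvd_X]) d₁ d₂ d₃
  have h := segreRetract_mem_map_productIdeal i j k g
  rw [← hg, segreRetract_segre] at h
  have h' : f ∈ Ideal.comap (Ideal.Quotient.mk _) (Ideal.map (Ideal.Quotient.mk
      (Ideal.span {(det : MvPolynomial (Fin 4) A)})) (productIdeal i j k)) := h
  rwa [Ideal.comap_map_of_surjective' _ Ideal.Quotient.mk_surjective, Ideal.mk_ker] at h'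

lemma tripleIdeal_le (m n : ℕ) :
    (tripleIdeal (X 0) (X 1) (X 2) (X 3) m (m + n) : Ideal (MvPolynomial (Fin 4) A)) ≤
      tripleIdeal (X 0) (X 1) (X 2) (X 3) 1 1 ^ m * Ideal.span {X 2, X 3} ^ n := by
  induction m with
  | zero => simp [tripleIdeal]
  | succ m ih =>
    rintro f ⟨⟨h₁, h₂⟩, h₃⟩
    obtain ⟨g, hg, r, hr, rfl⟩ := Submodule.mem_sup.1 (mem_productIdeal_sup_span_det h₁ h₂ h₃)
    obtain ⟨y, rfl⟩ := Ideal.mem_span_singleton.1 hr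
    have hgT := productIdeal_le (A := A) (m + 1) n hg
    refine add_mem hgT ?_
    have hgT' : g ∈ tripleIdeal (X 0) (X 1) (X 2) (X 3) (m + 1) (m + 1 + n) := by
      refine pow_mul_pow_le_tripleIdeal _ _ _ _ (Nat.le_add_right _ _) ?_
      rwa [tripleIdeal_zero_one, Nat.add_sub_cancel_left]
    obtain ⟨⟨g₁, g₂⟩, g₃⟩ := hgT'
    -- Both f and g lie in the intersection, hence so does Δy; Δ is then cancelled in each of the
    -- three powers.
    have hy : y ∈ tripleIdeal (X 0) (X 1) (X 2) (X 3) m (m + n) := by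
      refine ⟨⟨mem_pow_of_det_mul_mem_ab ((Ideal.add_mem_iff_right _ g₁).1 h₁),
        mem_pow_of_det_mul_mem_cd ?_⟩,
        mem_pow_of_det_mul_mem_sub ((Ideal.add_mem_iff_right _ g₃).1 h₃)⟩
      have := (Ideal.add_mem_iff_right _ g₂).1 h₂
      rwa [Nat.add_right_comm] at this
    rw [pow_succ', mul_assoc]
    exact Ideal.mul_mem_mul det_mem_tripleIdeal (ih hy)

theorem tripleIdeal_X_eq {m n : ℕ} (h : m ≤ n) :
    (tripleIdeal (X 0) (X 1) (X 2) (X 3) m n : Ideal (MvPolynomial (Fin 4) A)) =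
      tripleIdeal (X 0) (X 1) (X 2) (X 3) 1 1 ^ m *
        tripleIdeal (X 0) (X 1) (X 2) (X 3) 0 1 ^ (n - m) := by
  refine le_antisymm ?_ (pow_mul_pow_le_tripleIdeal _ _ _ _ h)
  obtain ⟨n, rfl⟩ := Nat.exists_eq_add_of_le h
  rw [tripleIdeal_zero_one, Nat.add_sub_cancel_left]
  exact tripleIdeal_le m n

end Segre

/-! ### Transfer to `J`, `J'` and `JLaurent`. -/

section Specialization

/-- The ring `ℂ[t₁, t₂, t₃, x₁, x₂, x₃]` is a polynomial ring in `t₁ - t₃`, `x₁ - x₃`, `t₂ - t₃`,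
`x₂ - x₃` over `ℂ[t₃, x₃]`. -/
noncomputable def polyTXEquiv : MvPolynomial (Fin 4) (MvPolynomial (Fin 2) ℂ) ≃+* PolyTX :=
  RingEquiv.ofRingHom
    (eval₂Hom (aeval ![t 2, x 2] : MvPolynomial (Fin 2) ℂ →ₐ[ℂ] PolyTX).toRingHom
      ![t 0 - t 2, x 0 - x 2, t 1 - t 2, x 1 - x 2])
    (aeval (Sum.elim ![X 0 + C (X 0), X 2 + C (X 0), C (X 0)]
      ![X 1 + C (X 1), X 3 + C (X 1), C (X 1)]) :
        PolyTX →ₐ[ℂ] MvPolynomial (Fin 4) (MvPolynomial (Fin 2) ℂ)).toRingHom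
    (by
      ext i
      · simp
      · rcases i with i | i <;> fin_cases i <;> simp [t, x])
    (by
      ext i
      · simp [MvPolynomial.algebraMap_eq, IsScalarTower.algebraMap_apply ℂ (MvPolynomial (Fin 2) ℂ)]
      · fin_cases i <;> simp [t, x]
      · fin_cases i <;> simp [t, x])

lemma polyTXEquiv_X_zero :
    (polyTXEquiv : MvPolynomial (Fin 4) (MvPolynomial (Fin 2) ℂ) →+* PolyTX) (X 0) = t 0 - t 2 := by
  simp [polyTXEquiv]

lemma polyTXEquiv_X_one :
    (polyTXEquiv : MvPolynomial (Fin 4) (MvPolynomial (Fin 2) ℂ) →+* PolyTX) (X 1) = x 0 - x 2 := by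
  simp [polyTXEquiv]

lemma polyTXEquiv_X_two :
    (polyTXEquiv : MvPolynomial (Fin 4) (MvPolynomial (Fin 2) ℂ) →+* PolyTX) (X 2) = t 1 - t 2 := by
  simp [polyTXEquiv]

lemma polyTXEquiv_X_three :
    (polyTXEquiv : MvPolynomial (Fin 4) (MvPolynomial (Fin 2) ℂ) →+* PolyTX) (X 3) = x 1 - x 2 := by
  simp [polyTXEquiv]

lemma J_eq (m n : ℕ) : J m n = tripleIdeal (X 0) (X 1) (X 2) (X 3) m n := rfl

/-- The differences from index 3 play a, b, c, d, because t₁ - t₂ = (t₁ - t₃) - (t₂ - t₃), and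
likewise for x. -/
lemma J'_eq (m n : ℕ) :
    J' m n = tripleIdeal (t 0 - t 2) (x 0 - x 2) (t 1 - t 2) (x 1 - x 2) m n := by
  rw [J', tripleIdeal, sub_sub_sub_cancel_right, sub_sub_sub_cancel_right, inf_comm (_ ^ m),
    inf_assoc, inf_assoc, inf_comm (_ ^ m) (_ ^ n)]

lemma JLaurent_eq (m n : ℕ) :
    JLaurent m n = tripleIdeal (tL 0 - tL 2) (xL 0 - xL 2) (tL 1 - tL 2) (xL 1 - xL 2) m n := by
  rw [JLaurent, tripleIdeal, sub_sub_sub_cancel_right, sub_sub_sub_cancel_right, inf_comm (_ ^ m),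
    inf_assoc, inf_assoc, inf_comm (_ ^ m) (_ ^ n)]

theorem J_eq_mul {m n : ℕ} (h : m ≤ n) : J m n = J 1 1 ^ m * J 0 1 ^ (n - m) := by
  simp only [J_eq]
  exact tripleIdeal_X_eq h

theorem J'_eq_mul {m n : ℕ} (h : m ≤ n) : J' m n = J' 1 1 ^ m * J' 0 1 ^ (n - m) := by
  simp only [J'_eq]
  have h' := tripleIdeal_eq_of_map
    (polyTXEquiv : MvPolynomial (Fin 4) (MvPolynomial (Fin 2) ℂ) →+* PolyTX)
    (map_inf_of_ringEquiv polyTXEquiv) (tripleIdeal_X_eq (A := MvPolynomial (Fin 2) ℂ) h)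
  rwa [polyTXEquiv_X_zero, polyTXEquiv_X_one, polyTXEquiv_X_two, polyTXEquiv_X_three] at h'

theorem JLaurent_eq_mul {m n : ℕ} (h : m ≤ n) :
    JLaurent m n = JLaurent 1 1 ^ m * JLaurent 0 1 ^ (n - m) := by
  have h' := J'_eq_mul h
  simp only [J'_eq] at h'
  simp only [JLaurent_eq]
  have := tripleIdeal_eq_of_map (algebraMap PolyTX LaurentTX)
    (IsLocalization.map_inf (Submonoid.powers (x 0 * x 1 * x 2)) LaurentTX) h'
  simpa only [map_sub, tL, xL] using this

end Specialization

end HaimanIdeal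

theorem corollary4p4 (d₁ d₂ : ℕ) (h : d₁ ≤ d₂) :
    HaimanIdeal.J d₁ d₂ = HaimanIdeal.J 1 1 ^ d₁ * HaimanIdeal.J 0 1 ^ (d₂ - d₁) ∧
    HaimanIdeal.J' d₁ d₂ = HaimanIdeal.J' 1 1 ^ d₁ * HaimanIdeal.J' 0 1 ^ (d₂ - d₁) ∧
    HaimanIdeal.JLaurent d₁ d₂ =
      HaimanIdeal.JLaurent 1 1 ^ d₁ * HaimanIdeal.JLaurent 0 1 ^ (d₂ - d₁) :=
  ⟨HaimanIdeal.J_eq_mul h, HaimanIdeal.J'_eq_mul h, HaimanIdeal.JLaurent_eq_mul h⟩
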